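/- An instance $C=(n,\mathbf p,\mathbf q)$ of $\textsc{Domination}$ consists of $\mathbf p,\mathbf q\in[0,1]^n$ with $p_i\ge q_i$ for all $i$. A hidden uniform bit $B$ is drawn; then independent bits $X_{i,j}, Y_{i,j}$ ($i\in[n]$, $j\in[r]$) are drawn with $X_{i,j}\sim\mathrm{Bernoulli}(p_i)$, $Y_{i,j}\sim\mathrm{Bernoulli}(q_i)$ if $B=0$, and $X_{i,j}\sim\mathrm{Bernoulli}(q_i)$, $Y_{i,j}\sim\mathrm{Bernoulli}(p_i)$ if $B=1$. A (possibly randomized) algorithm sees the arrays $X,Y$ only and succeeds if it outputs $B$. For an algorithm $A$ let $r_{\min}(C,A,s)$ be the least $r_0\in\mathbb N$ such that for every $r\ge r_0$ the algorithm $A$, given $r$ samples, succeeds with probability at least $s$ ($\infty$ if there is none), and let $r_{\min}(C,s)=\inf_A r_{\min}(C,A,s)$. Put $S_i=\sum_{j=1}^r (X_{i,j}-Y_{i,j})$. The counting algorithm $\mathcal A_{count}$ sets $Z=\sum_i S_i$; the max algorithm $\mathcal A_{max}$ sets $Z=S_{i'}$ with $i'=\arg\max_i|S_i|$, where ties are broken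 by an arbitrary fixed rule that depends only on the vector $(|S_1|,\dots,|S_n|)$. Both output $0$ if $Z>0$, $1$ if $Z<0$, and a fair coin flip if $Z=0$. Lemma. There are constants $c>0$ and $k\in\mathbb N$ such that for every sufficiently large $n$ the instance $C=(n,\mathbf p,\mathbf q)$ with $p_i=\frac12+\frac1{n^2}$ and $q_i=\frac12$ for all $i$ satisfies 1. $r_{\min}(C,\mathcal A_{count},1-\frac1n)\le 2n^3\ln n$; 2. $r_{\min}(C,\mathcal A_{max},\frac45)\ge \dfrac{n^4}{2^{14}\ln n}$; 3. $r_{\min}(C,\mathcal A_{max},\frac34)\ge \dfrac{c\,n}{(\ln n)^k}\; r_{\min}(C,\frac34)$, i.e. the competitive ratio of $\mathcal A_{max}$ is $\tilde\Omega(n)$. Here 2 and 3 hold, with the same $c$, $k$ and the same threshold on $n$, for every tie-breaking rule. -/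

import Mathlib

open scoped ENNReal

noncomputable section

namespace Domination

/-- An instance `(n, p, q)` of the domination problem: two vectors of probabilities with
`1 ≥ p i ≥ q i ≥ 0`. -/
structure DomInstance (n : ℕ) where
  p : Fin n → ℝ
  q : Fin n → ℝ
  q_nonneg : ∀ i, 0 ≤ q i
  q_le_p : ∀ i, q i ≤ p i
  p_le_one : ∀ i, p i ≤ 1

/-- An array of `r` binary samples for each of the `n` coordinates (`true` is the value `1`). -/
abbrev Samples (n r : ℕ) : Type := Fin n → Fin r → Bool

/-- A (randomized) algorithm on `n` coordinates: for every number `r` of samples and all sample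
arrays `X`, `Y`, the law of its output bit (`false` is the answer `B = 0`, `true` is `B = 1`). -/
abbrev DomAlgorithm (n : ℕ) : Type :=
  (r : ℕ) → Samples n r → Samples n r → PMF Bool

/-- The mass that the Bernoulli distribution with parameter `t` gives to the bit `b`. -/
def bernoulliMass (t : ℝ) (b : Bool) : ℝ := if b then t else 1 - t

/-- The probability of the array `x` when all entries are independent and the entry `(i, j)` is
Bernoulli with parameter `t i`. -/
def samplesMass {n : ℕ} (t : Fin n → ℝ) {r : ℕ} (x : Samples n r) : ℝ :=
  ∏ i, ∏ j, bernoulliMass (t i) (x i j)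

/-- The probability that `A` outputs the hidden bit `b`, given that the hidden bit is `b`:
for `b = false` the array `X` is drawn from `p` and `Y` from `q`, for `b = true` conversely. -/
def condSuccessProb {n : ℕ} (C : DomInstance n) (A : DomAlgorithm n) (r : ℕ) (b : Bool) : ℝ :=
  ∑ x : Samples n r, ∑ y : Samples n r,
    samplesMass (if b then C.q else C.p) x * samplesMass (if b then C.p else C.q) y *
      (A r x y b).toReal

/-- The probability that `A` outputs the hidden uniform bit when it is given `r` samples. -/
def successProb {n : ℕ} (C : DomInstance n) (A : DomAlgorithm n) (r : ℕ) : ℝ :=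
  (1 / 2) * condSuccessProb C A r false + (1 / 2) * condSuccessProb C A r true

/-- `r_min(C, A, s)`: the least `r₀` such that `A` succeeds with probability at least `s` for
every number `r ≥ r₀` of samples; it is `∞` if there is no such `r₀`. -/
def rMin {n : ℕ} (C : DomInstance n) (A : DomAlgorithm n) (s : ℝ) : ℝ≥0∞ :=
  ⨅ (r₀ : ℕ) (_ : ∀ r : ℕ, r₀ ≤ r → s ≤ successProb C A r), (r₀ : ℝ≥0∞)

/-- `r_min(C, s)`: the infimum of `r_min(C, A, s)` over all algorithms `A`. -/
def rMinBest {n : ℕ} (C : DomInstance n) (s : ℝ) : ℝ≥0∞ :=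
  ⨅ A : DomAlgorithm n, rMin C A s

/-- `S i = ∑ j, (X i j - Y i j)`. -/
def diffSum {n r : ℕ} (x y : Samples n r) (i : Fin n) : ℤ :=
  ∑ j, (((x i j).toNat : ℤ) - ((y i j).toNat : ℤ))

/-- Output `B = 0` if `z > 0`, `B = 1` if `z < 0`, and a fair coin if `z = 0`. -/
def signDecision (z : ℤ) : PMF Bool :=
  if 0 < z then PMF.pure false
  else if z < 0 then PMF.pure true
  else PMF.uniformOfFintype Bool

/-- The counting algorithm. -/
def countAlgorithm (n : ℕ) : DomAlgorithm n :=
  fun _ x y => signDecision (∑ i, diffSum x y i)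

/-- A way to read `arg max`: a function that assigns to each vector an index at which the vector
attains its maximum. -/
structure ArgmaxRule (n : ℕ) where
  idx : (Fin n → ℤ) → Fin n
  le_idx : ∀ (v : Fin n → ℤ) (i : Fin n), v i ≤ v (idx v)

/-- For `n ≥ 1` there is such a function. -/
theorem nonempty_argmaxRule {n : ℕ} (hn : 0 < n) : Nonempty (ArgmaxRule n) := by
  have : Nonempty (Fin n) := ⟨⟨0, hn⟩⟩
  choose f hf using fun v : Fin n → ℤ => Finite.exists_max v
  exact ⟨⟨f, hf⟩⟩

/-- The max algorithm, with the maximizer of `|S i|` chosen by the rule `σ`. -/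
def maxAlgorithm {n : ℕ} (σ : ArgmaxRule n) : DomAlgorithm n :=
  fun _ x y => signDecision (diffSum x y (σ.idx fun i => |diffSum x y i|))

end Domination

end

namespace Domination

open Finset

/-! Write e = 1/n². Counting pools all n·r pairs: a Chernoff bound gives error at most exp(-e²nr) =
exp(-r/n³), so about n³ ln n samples suffice (`one_sub_exp_le_successProb_count`).

The max algorithm in effect uses one row. Exchanging the selected row of X with that of Y is a
mass-changing involution: it keeps every |S_k|, hence the selected index under any tie-breaking
rule, negates Z, and changes the mass by a likelihood ratio exp(λZ) with λ ≤ 5e. While |Z| ≤ n²/16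
this ratio is at most 3/2, so the contribution to success is at most 3/5 (`expect_max_le`). For r ≤
n⁴/(2¹⁴ ln n), Chernoff and a union bound over rows make |Z| > n²/16 unlikely, and success stays
below 3/4 (`successProb_max_lt`). Comparing the two sample sizes gives the competitive ratio. -/

/-! ### Expectations and moment generating functions of the row sums. -/

theorem sum_samples_prod {n r : ℕ} (g : Fin n → Fin r → Bool → ℝ) :
    ∑ x : Samples n r, ∏ i, ∏ j, g i j (x i j) = ∏ i, ∏ j, ∑ b, g i j b := by
  have h (i : Fin n) : ∏ j, ∑ b, g i j b = ∑ u : Fin r → Bool, ∏ j, g i j (u j) := by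
    rw [Finset.prod_univ_sum, Fintype.piFinset_univ]
  simp_rw [h]
  rw [Finset.prod_univ_sum, Fintype.piFinset_univ]

/-- The expectation of `f` when `x` has parameters `p` and `y` has parameters `q`. -/
def expect {n r : ℕ} (p q : Fin n → ℝ) (f : Samples n r → Samples n r → ℝ) : ℝ :=
  ∑ x : Samples n r, ∑ y : Samples n r, samplesMass p x * samplesMass q y * f x y

theorem samplesMass_nonneg {n r : ℕ} {t : Fin n → ℝ} (h0 : ∀ i, 0 ≤ t i) (h1 : ∀ i, t i ≤ 1)
    (x : Samples n r) : 0 ≤ samplesMass t x := by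
  refine prod_nonneg fun i _ => prod_nonneg fun j _ => ?_
  unfold bernoulliMass
  split_ifs
  · exact h0 i
  · linarith [h1 i]

theorem sum_samplesMass {n r : ℕ} (t : Fin n → ℝ) : ∑ x : Samples n r, samplesMass t x = 1 := by
  unfold samplesMass
  rw [sum_samples_prod fun i _ b => bernoulliMass (t i) b]
  simp [bernoulliMass]

section expect

variable {n r : ℕ} {p q : Fin n → ℝ}

theorem expect_const (c : ℝ) : expect (r := r) p q (fun _ _ => c) = c := by
  simp only [expect, ← sum_mul, ← mul_sum, sum_samplesMass]
  ring

theorem expect_add (f g : Samples n r → Samples n r → ℝ) :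
    expect p q (fun x y => f x y + g x y) = expect p q f + expect p q g := by
  simp only [expect, mul_add, sum_add_distrib]

theorem expect_mul_const (f : Samples n r → Samples n r → ℝ) (c : ℝ) :
    expect p q (fun x y => f x y * c) = expect p q f * c := by
  simp only [expect, sum_mul, mul_assoc]

theorem expect_sum {ι : Type*} (s : Finset ι) (f : ι → Samples n r → Samples n r → ℝ) :
    expect p q (fun x y => ∑ i ∈ s, f i x y) = ∑ i ∈ s, expect p q (f i) := by
  simp only [expect, mul_sum]
  rw [sum_comm]
  conv_rhs => rw [sum_comm]
  rw [sum_comm]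
  refine sum_congr rfl fun x _ => ?_
  rw [sum_comm]

theorem expect_mono (hp : ∀ i, 0 ≤ p i) (hp' : ∀ i, p i ≤ 1) (hq : ∀ i, 0 ≤ q i)
    (hq' : ∀ i, q i ≤ 1) {f g : Samples n r → Samples n r → ℝ} (h : ∀ x y, f x y ≤ g x y) :
    expect p q f ≤ expect p q g :=
  sum_le_sum fun x _ => sum_le_sum fun y _ => mul_le_mul_of_nonneg_left (h x y)
    (mul_nonneg (samplesMass_nonneg hp hp' x) (samplesMass_nonneg hq hq' y))

/-- Independence: the exponential of a linear form in the bits factors over the entries. -/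
theorem expect_exp_diffSum (l : Fin n → ℝ) :
    expect (r := r) p q (fun x y => Real.exp (∑ i, l i * diffSum x y i)) =
      ∏ i, ((p i * Real.exp (l i) + (1 - p i)) * (q i * Real.exp (-l i) + (1 - q i))) ^ r := by
  have h (x y : Samples n r) : samplesMass p x * samplesMass q y *
        Real.exp (∑ i, l i * diffSum x y i) =
      (∏ i, ∏ j, bernoulliMass (p i) (x i j) * Real.exp (l i * (x i j).toNat)) *
      (∏ i, ∏ j, bernoulliMass (q i) (y i j) * Real.exp (-l i * (y i j).toNat)) := by
    simp only [prod_mul_distrib, ← Real.exp_sum, samplesMass]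
    rw [mul_mul_mul_comm, ← Real.exp_add, ← sum_add_distrib]
    congr 2
    refine sum_congr rfl fun i _ => ?_
    rw [← sum_add_distrib, diffSum]
    push_cast
    rw [mul_sum]
    exact sum_congr rfl fun j _ => by ring
  simp only [expect, h]
  rw [← sum_mul_sum,
    sum_samples_prod fun i _ b => bernoulliMass (p i) b * Real.exp (l i * b.toNat),
    sum_samples_prod fun i _ b => bernoulliMass (q i) b * Real.exp (-l i * b.toNat),
    ← prod_mul_distrib]
  refine prod_congr rfl fun i _ => ?_
  simp [bernoulliMass, mul_pow]

theorem expect_exp_diffSum_single (i : Fin n) (l : ℝ) :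
    expect (r := r) p q (fun x y => Real.exp (l * diffSum x y i)) =
      ((p i * Real.exp l + (1 - p i)) * (q i * Real.exp (-l) + (1 - q i))) ^ r := by
  have h := expect_exp_diffSum (r := r) (p := p) (q := q) (Pi.single i l)
  rw [prod_eq_single i] at h
  · simpa [Pi.single_apply, ite_mul] using h
  · intro j _ hj
    simp [hj]
  · simp

end expect

/-! ### Symmetry in the hidden bit, and thresholds. -/

theorem diffSum_swap {n r : ℕ} (x y : Samples n r) (i : Fin n) :
    diffSum y x i = -diffSum x y i := by
  simp [diffSum]

theorem signDecision_neg_true (z : ℤ) : signDecision (-z) true = signDecision z false := by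
  unfold signDecision
  rcases lt_trichotomy z 0 with h | h | h
  · simp [h, h.not_gt]
  · simp [h]
  · simp [h, h.not_gt]

theorem signDecision_false_toReal (z : ℤ) : (signDecision z false).toReal =
    if 0 < z then 1 else if z < 0 then 0 else 1 / 2 := by
  unfold signDecision
  split_ifs <;> simp

/-- An algorithm whose answer is reversed when the two arrays are exchanged succeeds equally often
for both values of the hidden bit. -/
theorem successProb_eq_expect {n : ℕ} (C : DomInstance n) (A : DomAlgorithm n) (r : ℕ)
    (hA : ∀ x y, A r y x true = A r x y false) :
    successProb C A r = expect C.p C.q fun x y => (A r x y false).toReal := by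
  have h0 : condSuccessProb C A r false = expect C.p C.q fun x y => (A r x y false).toReal := by
    simp [condSuccessProb, expect]
  have h1 : condSuccessProb C A r true = expect C.p C.q fun x y => (A r x y false).toReal := by
    simp only [condSuccessProb, expect, if_true]
    rw [sum_comm]
    refine sum_congr rfl fun x _ => sum_congr rfl fun y _ => ?_
    rw [hA, mul_comm (samplesMass C.q y)]
  rw [successProb, h0, h1]
  ring

theorem rMin_mono {n : ℕ} (C : DomInstance n) (A : DomAlgorithm n) {s t : ℝ} (h : s ≤ t) :
    rMin C A s ≤ rMin C A t :=
  le_iInf₂ fun r₀ hr => iInf₂_le r₀ fun r hr' => h.trans (hr r hr')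

/-- A failure at `r` rules out every threshold up to `r`, so `r + 1` is a lower bound; this absorbs
the rounding when `r` is a floor. -/
theorem le_rMin_of_successProb_lt {n : ℕ} {C : DomInstance n} {A : DomAlgorithm n} {s a : ℝ}
    {r : ℕ} (ha : a ≤ r + 1) (h : successProb C A r < s) : ENNReal.ofReal a ≤ rMin C A s := by
  refine le_iInf₂ fun r₀ hr => ?_
  have h1 : r + 1 ≤ r₀ := by
    by_contra hlt
    exact absurd (hr r (by omega)) h.not_ge
  refine ENNReal.ofReal_le_of_le_toReal ?_
  rw [ENNReal.toReal_natCast]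
  exact ha.trans (by exact_mod_cast h1)

/-! ### Chernoff bound for the counting algorithm. -/

section count

variable {n : ℕ} (C : DomInstance n) (r : ℕ)

theorem successProb_count : successProb C (countAlgorithm n) r =
    expect C.p C.q fun (x y : Samples n r) =>
      (signDecision (∑ i, diffSum x y i) false).toReal := by
  refine successProb_eq_expect C _ r fun x y => ?_
  simp only [countAlgorithm]
  rw [← signDecision_neg_true, ← sum_neg_distrib]
  simp only [diffSum_swap x y]

theorem one_sub_le_successProb_count {l : ℝ} (hl : 0 ≤ l) :
    1 - ∏ i, ((C.p i * Real.exp (-l) + (1 - C.p i)) * (C.q i * Real.exp l + (1 - C.q i))) ^ r ≤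
      successProb C (countAlgorithm n) r := by
  have h := expect_exp_diffSum (r := r) (p := C.p) (q := C.q) fun _ => -l
  simp only [neg_neg] at h
  rw [successProb_count, ← h, sub_le_iff_le_add, ← expect_add,
    ← expect_const (p := C.p) (q := C.q) (r := r) 1]
  refine expect_mono (fun i => (C.q_nonneg i).trans (C.q_le_p i)) C.p_le_one C.q_nonneg
    (fun i => (C.q_le_p i).trans (C.p_le_one i)) fun x y => ?_
  rw [signDecision_false_toReal, ← mul_sum, ← Int.cast_sum]
  set z := ∑ i, diffSum x y i
  have hpos := Real.exp_pos (-l * z)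
  split_ifs with h1 h2
  · linarith
  all_goals
    have hz : (z : ℝ) ≤ 0 := by exact_mod_cast not_lt.1 h1
    have : 1 ≤ Real.exp (-l * z) := Real.one_le_exp (by nlinarith)
    linarith

end count

/-! ### The row exchange and its likelihood ratio. -/

section rowSwap

variable {n r : ℕ}

/-- Exchange of the `i`-th rows of the two arrays. -/
def rowSwap (i : Fin n) (w : Samples n r × Samples n r) : Samples n r × Samples n r :=
  (Function.update w.1 i (w.2 i), Function.update w.2 i (w.1 i))

theorem rowSwap_rowSwap (i : Fin n) (w : Samples n r × Samples n r) :
    rowSwap i (rowSwap i w) = w := by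
  simp [rowSwap]

theorem diffSum_rowSwap_self (i : Fin n) (w : Samples n r × Samples n r) :
    diffSum (rowSwap i w).1 (rowSwap i w).2 i = -diffSum w.1 w.2 i := by
  simp [rowSwap, diffSum]

theorem abs_diffSum_rowSwap (i k : Fin n) (w : Samples n r × Samples n r) :
    |diffSum (rowSwap i w).1 (rowSwap i w).2 k| = |diffSum w.1 w.2 k| := by
  by_cases h : k = i
  · subst h
    rw [diffSum_rowSwap_self, abs_neg]
  · simp [rowSwap, diffSum, h]

/-- Exchange of the rows selected by `σ`. -/
def argmaxSwap (σ : ArgmaxRule n) (w : Samples n r × Samples n r) : Samples n r × Samples n r :=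
  rowSwap (σ.idx fun k => |diffSum w.1 w.2 k|) w

/-- The rule sees only absolute values, which the exchange preserves; this is what makes
`argmaxSwap` an involution. -/
theorem idx_argmaxSwap (σ : ArgmaxRule n) (w : Samples n r × Samples n r) :
    (σ.idx fun k => |diffSum (argmaxSwap σ w).1 (argmaxSwap σ w).2 k|) =
      σ.idx fun k => |diffSum w.1 w.2 k| := by
  simp only [argmaxSwap, abs_diffSum_rowSwap]

theorem argmaxSwap_involutive (σ : ArgmaxRule n) :
    Function.Involutive (argmaxSwap σ : Samples n r × Samples n r → _) := by
  intro w
  conv_lhs => rw [argmaxSwap, idx_argmaxSwap]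
  rw [argmaxSwap, rowSwap_rowSwap]

theorem samplesMass_update (t : Fin n → ℝ) (x : Samples n r) (i : Fin n) (u : Fin r → Bool) :
    samplesMass t (Function.update x i u) =
      (∏ j, bernoulliMass (t i) (u j)) * ∏ k ∈ univ.erase i, ∏ j, bernoulliMass (t k) (x k j) := by
  rw [samplesMass, ← mul_prod_erase univ _ (mem_univ i)]
  congr 1
  · simp
  · refine prod_congr rfl fun k hk => ?_
    simp [(mem_erase.1 hk).1]

theorem bernoulliMass_mul_exchange {p q : ℝ} (hp : 0 < p) (hp' : p < 1) (hq : 0 < q) (hq' : q < 1)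
    (a b : Bool) :
    bernoulliMass p a * bernoulliMass q b =
      Real.exp (Real.log (p * (1 - q) / ((1 - p) * q)) * ((a.toNat : ℝ) - b.toNat)) *
        (bernoulliMass p b * bernoulliMass q a) := by
  have h1 : 0 < 1 - p := by linarith
  have h2 : 0 < 1 - q := by linarith
  have h3 : 0 < p * (1 - q) / ((1 - p) * q) := by positivity
  cases a <;> cases b <;> simp [bernoulliMass, Real.exp_neg, Real.exp_log h3] <;> field_simp

/-- The exchange of the `i`-th rows changes the mass by the likelihood ratio. -/
theorem mass_rowSwap {p q : Fin n → ℝ} {i : Fin n} (hp : 0 < p i) (hp' : p i < 1) (hq : 0 < q i)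
    (hq' : q i < 1) (w : Samples n r × Samples n r) :
    samplesMass p w.1 * samplesMass q w.2 =
      Real.exp (Real.log (p i * (1 - q i) / ((1 - p i) * q i)) * diffSum w.1 w.2 i) *
        (samplesMass p (rowSwap i w).1 * samplesMass q (rowSwap i w).2) := by
  obtain ⟨x, y⟩ := w
  have hx := samplesMass_update p x i (x i)
  have hy := samplesMass_update q y i (y i)
  rw [Function.update_eq_self] at hx hy
  have key : (∏ j, bernoulliMass (p i) (x i j)) * ∏ j, bernoulliMass (q i) (y i j) =
      Real.exp (Real.log (p i * (1 - q i) / ((1 - p i) * q i)) * diffSum x y i) *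
        ((∏ j, bernoulliMass (p i) (y i j)) * ∏ j, bernoulliMass (q i) (x i j)) := by
    rw [← prod_mul_distrib, ← prod_mul_distrib, diffSum]
    push_cast
    rw [mul_sum, Real.exp_sum, ← prod_mul_distrib]
    exact prod_congr rfl fun j _ => bernoulliMass_mul_exchange hp hp' hq hq' _ _
  simp only [rowSwap, samplesMass_update, hx, hy]
  rw [mul_mul_mul_comm, key]
  ring

end rowSwap

/-! ### Upper bound on the success of the max algorithm. -/

section max

variable {n : ℕ} (C : DomInstance n) (σ : ArgmaxRule n) (r : ℕ)

theorem successProb_max : successProb C (maxAlgorithm σ) r =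
    expect C.p C.q fun (x y : Samples n r) =>
      (signDecision (diffSum x y (σ.idx fun i => |diffSum x y i|)) false).toReal := by
  refine successProb_eq_expect C _ r fun x y => ?_
  simp only [maxAlgorithm]
  rw [← signDecision_neg_true]
  simp only [diffSum_swap x y, abs_neg]

open Classical in
/-- When the likelihood ratio of a row is at most `ρ` on the event `|S i'| ≤ M`, the max algorithm
succeeds on that event with probability at most `ρ / (1 + ρ)`. -/
theorem expect_max_le {M ρ : ℝ} (hρ : 1 ≤ ρ) (hq : ∀ i, 0 < C.q i) (hp : ∀ i, C.p i < 1)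
    (hM : ∀ i, Real.log (C.p i * (1 - C.q i) / ((1 - C.p i) * C.q i)) * M ≤ Real.log ρ) :
    (expect C.p C.q fun (x y : Samples n r) =>
      if |(diffSum x y (σ.idx fun i => |diffSum x y i|) : ℝ)| ≤ M then
        (signDecision (diffSum x y (σ.idx fun i => |diffSum x y i|)) false).toReal else 0) ≤
      ρ / (1 + ρ) := by
  let m (w : Samples n r × Samples n r) : ℝ := samplesMass C.p w.1 * samplesMass C.q w.2
  let z (w : Samples n r × Samples n r) : ℤ :=
    diffSum w.1 w.2 (σ.idx fun i => |diffSum w.1 w.2 i|)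
  let f (w : Samples n r × Samples n r) : ℝ :=
    if |(z w : ℝ)| ≤ M then (signDecision (z w) false).toReal else 0
  have hp0 (i) : 0 < C.p i := (hq i).trans_le (C.q_le_p i)
  have hq1 (i) : C.q i < 1 := (C.q_le_p i).trans_lt (hp i)
  have hm (w) : 0 ≤ m w := mul_nonneg
    (samplesMass_nonneg (fun i => (hp0 i).le) C.p_le_one w.1)
    (samplesMass_nonneg C.q_nonneg (fun i => (hq1 i).le) w.2)
  have hz (w) : z (argmaxSwap σ w) = -z w := by
    simp only [z, idx_argmaxSwap]
    rw [argmaxSwap, diffSum_rowSwap_self]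
  have hle (w) (hw : |(z w : ℝ)| ≤ M) : m w ≤ ρ * m (argmaxSwap σ w) := by
    set i := σ.idx fun k => |diffSum w.1 w.2 k|
    have h1 : m w = _ := mass_rowSwap (hp0 i) (hp i) (hq i) (hq1 i) w
    rw [h1]
    refine mul_le_mul_of_nonneg_right ?_ (hm (argmaxSwap σ w))
    rw [← Real.le_log_iff_exp_le (by linarith)]
    refine le_trans (mul_le_mul_of_nonneg_left ((le_abs_self _).trans hw) ?_) (hM i)
    refine Real.log_nonneg ?_
    have h2 : 0 < (1 - C.p i) * C.q i := mul_pos (by linarith [hp i]) (hq i)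
    rw [le_div_iff₀ h2]
    nlinarith [C.q_le_p i]
  have hs : ∑ w, m w = 1 := by
    have := expect_const (p := C.p) (q := C.q) (r := r) 1
    simpa [expect, m, Fintype.sum_prod_type] using this
  have hT : (expect C.p C.q fun (x y : Samples n r) =>
      if |(diffSum x y (σ.idx fun i => |diffSum x y i|) : ℝ)| ≤ M then
        (signDecision (diffSum x y (σ.idx fun i => |diffSum x y i|)) false).toReal else 0) =
      ∑ w, m w * f w := by
    rw [Fintype.sum_prod_type]
    rfl
  rw [hT]
  let e := (argmaxSwap_involutive (r := r) σ).toPerm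
  have e1 : ∑ w, m (argmaxSwap σ w) * f (argmaxSwap σ w) = ∑ w, m w * f w :=
    Equiv.sum_comp e fun w => m w * f w
  have e2 : ∑ w, m (argmaxSwap σ w) = 1 := (Equiv.sum_comp e m).trans hs
  -- Of `w` and its exchange at most one is answered correctly, and its mass is at most `ρ` times
  -- the other's; if Z = 0 both count one half.
  have hpair (w) : m w * f w + m (argmaxSwap σ w) * f (argmaxSwap σ w) ≤
      ρ / (1 + ρ) * (m w + m (argmaxSwap σ w)) := by
    have h1 := hm w
    have h2 := hm (argmaxSwap σ w)
    rw [div_mul_eq_mul_div, le_div_iff₀ (by linarith)]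
    by_cases hw : |(z w : ℝ)| ≤ M
    · have h3 := hle w hw
      have h4 := hle (argmaxSwap σ w) (by rw [hz]; simpa using hw)
      rw [argmaxSwap_involutive σ w] at h4
      simp only [f, hz, Int.cast_neg, abs_neg, if_pos hw, signDecision_false_toReal,
        Left.neg_pos_iff, Left.neg_neg_iff]
      rcases lt_trichotomy (z w) 0 with h | h | h
      · simp only [h, h.not_gt, if_true, if_false]
        nlinarith
      · simp only [h, lt_irrefl, if_false]
        nlinarith
      · simp only [h, h.not_gt, if_true, if_false]
        nlinarith
    · have hw' : ¬|(z (argmaxSwap σ w) : ℝ)| ≤ M := by rw [hz]; simpa using hw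
      simp only [f, if_neg hw, if_neg hw', mul_zero, add_zero, zero_mul]
      positivity
  have := sum_le_sum fun w (_ : w ∈ univ) => hpair w
  rw [sum_add_distrib, e1, ← mul_sum, sum_add_distrib, hs, e2] at this
  linarith

/-- On |Z| > M success is bounded by 1, then by exponential Markov in both directions, summed over
all rows as a union bound. -/
theorem successProb_max_le {M ρ l : ℝ} (hl : 0 ≤ l) (hρ : 1 ≤ ρ) (hq : ∀ i, 0 < C.q i)
    (hp : ∀ i, C.p i < 1)
    (hM : ∀ i, Real.log (C.p i * (1 - C.q i) / ((1 - C.p i) * C.q i)) * M ≤ Real.log ρ) :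
    successProb C (maxAlgorithm σ) r ≤ ρ / (1 + ρ) + ∑ i,
      (((C.p i * Real.exp l + (1 - C.p i)) * (C.q i * Real.exp (-l) + (1 - C.q i))) ^ r +
        ((C.p i * Real.exp (-l) + (1 - C.p i)) * (C.q i * Real.exp l + (1 - C.q i))) ^ r) *
      Real.exp (-(l * M)) := by
  classical
  rw [successProb_max]
  refine le_trans ?_ (add_le_add_left (expect_max_le C σ r hρ hq hp hM) _)
  have h (i : Fin n) := expect_exp_diffSum_single (r := r) (p := C.p) (q := C.q) i (-l)
  simp only [neg_neg] at h
  simp_rw [← h, ← expect_exp_diffSum_single, ← expect_add, ← expect_mul_const]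
  rw [← expect_sum, ← expect_add]
  refine expect_mono (fun i => (C.q_nonneg i).trans (C.q_le_p i)) C.p_le_one C.q_nonneg
    (fun i => (C.q_le_p i).trans (C.p_le_one i)) fun x y => ?_
  set i := σ.idx fun i => |diffSum x y i|
  have hnn (k : Fin n) : 0 ≤ (Real.exp (l * diffSum x y k) + Real.exp (-l * diffSum x y k)) *
      Real.exp (-(l * M)) := by positivity
  split_ifs with hw
  · exact le_add_of_nonneg_right (sum_nonneg fun k _ => hnn k)
  · rw [zero_add]
    refine le_trans ?_ (single_le_sum (fun k _ => hnn k) (mem_univ i))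
    have h1 : (signDecision (diffSum x y i) false).toReal ≤ 1 := by
      rw [signDecision_false_toReal]
      split_ifs <;> norm_num
    refine h1.trans ?_
    rw [add_mul, ← Real.exp_add, ← Real.exp_add]
    rcases lt_abs.1 (not_le.1 hw) with h2 | h2
    · exact le_add_of_le_of_nonneg (Real.one_le_exp (by nlinarith)) (Real.exp_pos _).le
    · exact le_add_of_nonneg_of_le (Real.exp_pos _).le (Real.one_le_exp (by nlinarith))

end max

/-! ### Numerical estimates for the instance. -/

theorem one_sub_exp_le_successProb_count {n : ℕ} {C : DomInstance n} {e : ℝ} (he : 0 ≤ e)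
    (hC : ∀ i, C.p i = 1 / 2 + e ∧ C.q i = 1 / 2) (he' : e ≤ 1 / 2) (r : ℕ) :
    1 - Real.exp (-(e ^ 2 * (n * r))) ≤ successProb C (countAlgorithm n) r := by
  have hw : 0 < 1 + 2 * e := by linarith
  refine le_trans ?_ (one_sub_le_successProb_count C r
    (Real.log_nonneg (by linarith : 1 ≤ 1 + 2 * e)))
  -- With weight `1 + 2 * e` the two factors are exactly 1 - e and 1 + e.
  have h (i : Fin n) : (C.p i * Real.exp (-Real.log (1 + 2 * e)) + (1 - C.p i)) *
      (C.q i * Real.exp (Real.log (1 + 2 * e)) + (1 - C.q i)) = 1 - e ^ 2 := by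
    rw [(hC i).1, (hC i).2, Real.exp_neg, Real.exp_log hw]
    field_simp
    ring
  simp only [h, prod_const, card_univ, Fintype.card_fin]
  have h1 : 1 - e ^ 2 ≤ Real.exp (-e ^ 2) := by linarith [Real.add_one_le_exp (-e ^ 2)]
  have h2 := pow_le_pow_left₀ (by nlinarith : 0 ≤ 1 - e ^ 2) h1 (r * n)
  rw [← Real.exp_nat_mul] at h2
  rw [← pow_mul]
  have h3 : ((r * n : ℕ) : ℝ) * -e ^ 2 = -(e ^ 2 * (n * r)) := by push_cast; ring
  rw [h3] at h2
  linarith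

/-- Taking the exponent as `log (1 + d)` makes both products rational in `d`, so 1 + t ≤ exp t
finishes. -/
theorem mgf_le {e d : ℝ} (he : 0 ≤ e) (hd : 0 ≤ d) :
    ((1 / 2 + e) * Real.exp (Real.log (1 + d)) + (1 - (1 / 2 + e))) *
      (1 / 2 * Real.exp (-Real.log (1 + d)) + (1 - 1 / 2)) ≤ Real.exp (d ^ 2 / 4 + e * d) ∧
    ((1 / 2 + e) * Real.exp (-Real.log (1 + d)) + (1 - (1 / 2 + e))) *
      (1 / 2 * Real.exp (Real.log (1 + d)) + (1 - 1 / 2)) ≤ Real.exp (d ^ 2 / 4 + e * d) := by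
  have hw : 0 < 1 + d := by linarith
  have hed : 0 ≤ e * d := mul_nonneg he hd
  have hedd : 0 ≤ e * d * d := mul_nonneg hed hd
  have hd3 : 0 ≤ d ^ 2 * d := by positivity
  have h := Real.add_one_le_exp (d ^ 2 / 4 + e * d)
  rw [Real.exp_neg, Real.exp_log hw]
  constructor
  · refine le_trans ?_ h
    have : ((1 / 2 + e) * (1 + d) + (1 - (1 / 2 + e))) * (1 / 2 * (1 + d)⁻¹ + (1 - 1 / 2)) =
        ((1 + d / 2 + e * d) * (1 + d / 2)) / (1 + d) := by
      field_simp
      ring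
    rw [this, div_le_iff₀ hw]
    nlinarith
  · refine le_trans ?_ h
    have : ((1 / 2 + e) * (1 + d)⁻¹ + (1 - (1 / 2 + e))) * (1 / 2 * (1 + d) + (1 - 1 / 2)) =
        ((1 + d / 2 - e * d) * (1 + d / 2)) / (1 + d) := by
      field_simp
      ring
    rw [this, div_le_iff₀ hw]
    nlinarith

theorem half_le_log_one_add {d : ℝ} (hd : 0 ≤ d) (hd' : d ≤ 1) : d / 2 ≤ Real.log (1 + d) := by
  have hw : 0 < 1 + d := by linarith
  refine le_trans ?_ (Real.one_sub_inv_le_log_of_pos hw)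
  have : 1 - (1 + d)⁻¹ = d / (1 + d) := by field_simp; ring
  rw [this]
  gcongr
  linarith

theorem successProb_max_lt {n : ℕ} {C : DomInstance n}
    (hC : ∀ i, C.p i = 1 / 2 + 1 / (n : ℝ) ^ 2 ∧ C.q i = 1 / 2) (σ : ArgmaxRule n) {r : ℕ}
    (hn : 64 ≤ n) (hL : 4 ≤ Real.log n)
    (hr : (r : ℝ) ≤ (n : ℝ) ^ 4 / (2 ^ 14 * Real.log n)) :
    successProb C (maxAlgorithm σ) r < 3 / 4 := by
  have hN : (64 : ℝ) ≤ n := by exact_mod_cast hn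
  set N : ℝ := (n : ℝ)
  set L := Real.log N
  have hLN : L ≤ N := by linarith [Real.log_le_sub_one_of_pos (by linarith : 0 < N)]
  have hN2 : 0 < N ^ 2 := by positivity
  set e := 1 / N ^ 2 with he
  have he0 : 0 < e := by positivity
  have he1 : e ≤ 1 / 10 := by
    rw [he, div_le_div_iff₀ hN2 (by norm_num)]
    nlinarith
  -- Chosen so that log(1 + d)·N²/16 ≥ 2L, while r(d²/4 + ed) ≤ L/16 + 1/256.
  set d := 64 * L / N ^ 2 with hd
  have hd0 : 0 ≤ d := by positivity
  have hd1 : d ≤ 1 := by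
    rw [hd, div_le_one hN2]
    nlinarith
  have hlog := half_le_log_one_add hd0 hd1
  -- The log ratio is at most 5e, and 5/16 ≤ 1/3 ≤ log(3/2).
  have hM (i : Fin n) : Real.log (C.p i * (1 - C.q i) / ((1 - C.p i) * C.q i)) * (N ^ 2 / 16) ≤
      Real.log (3 / 2) := by
    have h1 : C.p i * (1 - C.q i) / ((1 - C.p i) * C.q i) = (1 / 2 + e) / (1 / 2 - e) := by
      rw [(hC i).1, (hC i).2]
      have : 1 / 2 - e ≠ 0 := by linarith
      have : 1 - (1 / 2 + e) ≠ 0 := by linarith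
      field_simp
      ring
    have h2 : 0 < 1 / 2 - e := by linarith
    have h3 : Real.log ((1 / 2 + e) / (1 / 2 - e)) ≤ 5 * e := by
      refine (Real.log_le_sub_one_of_pos (by positivity)).trans ?_
      rw [sub_le_iff_le_add, div_le_iff₀ h2]
      nlinarith
    have h4 := Real.one_sub_inv_le_log_of_pos (by norm_num : (0 : ℝ) < 3 / 2)
    have h5 : e * N ^ 2 = 1 := by rw [he]; field_simp
    rw [h1]
    norm_num at h4
    nlinarith
  have hmain := successProb_max_le C σ r (Real.log_nonneg (by linarith : 1 ≤ 1 + d))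
    (by norm_num : (1 : ℝ) ≤ 3 / 2) (fun i => by rw [(hC i).2]; norm_num)
    (fun i => by rw [(hC i).1]; linarith) hM
  refine hmain.trans_lt ?_
  have hexp : Real.exp (d ^ 2 / 4 + e * d) ^ r ≤ Real.exp (L / 16 + 1 / 256) := by
    rw [← Real.exp_nat_mul, Real.exp_le_exp]
    refine (mul_le_mul_of_nonneg_right hr (by positivity)).trans (le_of_eq ?_)
    rw [hd, he]
    field_simp
    ring
  have htail : Real.exp (-(Real.log (1 + d) * (N ^ 2 / 16))) ≤ Real.exp (-(2 * L)) := by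
    rw [Real.exp_le_exp, neg_le_neg_iff]
    have : d * N ^ 2 = 64 * L := by rw [hd]; field_simp
    nlinarith
  have hterm (i : Fin n) :
      (((C.p i * Real.exp (Real.log (1 + d)) + (1 - C.p i)) *
          (C.q i * Real.exp (-Real.log (1 + d)) + (1 - C.q i))) ^ r +
        ((C.p i * Real.exp (-Real.log (1 + d)) + (1 - C.p i)) *
          (C.q i * Real.exp (Real.log (1 + d)) + (1 - C.q i))) ^ r) *
      Real.exp (-(Real.log (1 + d) * (N ^ 2 / 16))) ≤
      2 * Real.exp (L / 16 + 1 / 256) * Real.exp (-(2 * L)) := by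
    rw [(hC i).1, (hC i).2]
    obtain ⟨h1, h2⟩ := mgf_le he0.le hd0
    have hpos : 0 ≤ 1 - (1 / 2 + e) := by linarith
    refine mul_le_mul ?_ htail (Real.exp_pos _).le (by positivity)
    rw [two_mul]
    exact add_le_add ((pow_le_pow_left₀ (by positivity) h1 r).trans hexp)
      ((pow_le_pow_left₀ (by positivity) h2 r).trans hexp)
  have hsum := sum_le_sum fun i (_ : i ∈ univ) => hterm i
  rw [sum_const, card_univ, Fintype.card_fin, nsmul_eq_mul] at hsum
  have hNL : N = Real.exp L := (Real.exp_log (by linarith)).symm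
  have hfin : (n : ℝ) * (2 * Real.exp (L / 16 + 1 / 256) * Real.exp (-(2 * L))) ≤
      2 * Real.exp (-3) := by
    have : (n : ℝ) * (2 * Real.exp (L / 16 + 1 / 256) * Real.exp (-(2 * L))) =
        2 * Real.exp (L + (L / 16 + 1 / 256) + -(2 * L)) := by
      rw [Real.exp_add _ (-(2 * L)), Real.exp_add L, ← hNL]
      ring
    rw [this]
    gcongr
    linarith
  -- The tail may use up the gap 3/4 - 3/5 = 3/20.
  have h3 : 2 * Real.exp (-3) < 3 / 20 := by
    have h4 : Real.exp (-3) = (Real.exp 1 ^ 3)⁻¹ := by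
      rw [← Real.exp_nat_mul, ← Real.exp_neg]
      norm_num
    have h5 : (2.7 : ℝ) ^ 3 ≤ Real.exp 1 ^ 3 :=
      pow_le_pow_left₀ (by norm_num) (by linarith [Real.exp_one_gt_d9]) 3
    rw [h4, ← div_eq_mul_inv, div_lt_iff₀ (by positivity)]
    norm_num at h5 ⊢
    linarith
  have h6 : (3 / 2 : ℝ) / (1 + 3 / 2) = 3 / 5 := by norm_num
  rw [h6]
  linarith

theorem rMin_count_le {n : ℕ} {C : DomInstance n}
    (hC : ∀ i, C.p i = 1 / 2 + 1 / (n : ℝ) ^ 2 ∧ C.q i = 1 / 2) (hn : 64 ≤ n)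
    (hL : 4 ≤ Real.log n) :
    rMin C (countAlgorithm n) (1 - 1 / (n : ℝ)) ≤
      ENNReal.ofReal (2 * (n : ℝ) ^ 3 * Real.log n) := by
  have hN : (64 : ℝ) ≤ n := by exact_mod_cast hn
  have hN0 : (0 : ℝ) < n := by linarith
  have hN3 : (1 : ℝ) ≤ (n : ℝ) ^ 3 := one_le_pow₀ (by linarith)
  have h0 : 0 ≤ 2 * (n : ℝ) ^ 3 * Real.log n := by positivity
  -- The threshold must be a natural number below the bound, hence the floor; r ≥ n³ ln n already
  -- suffices, so the factor 2 covers the rounding.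
  refine (iInf₂_le ⌊2 * (n : ℝ) ^ 3 * Real.log n⌋₊ fun r hr => ?_).trans ?_
  · have hr1 : 2 * (n : ℝ) ^ 3 * Real.log n < r + 1 :=
      (Nat.lt_floor_add_one _).trans_le (by exact_mod_cast Nat.succ_le_succ hr)
    have hr2 : (n : ℝ) ^ 3 * Real.log n ≤ r := by nlinarith
    have he' : 1 / (n : ℝ) ^ 2 ≤ 1 / 2 := by
      rw [div_le_div_iff₀ (by positivity) (by norm_num)]
      nlinarith
    refine le_trans ?_ (one_sub_exp_le_successProb_count (by positivity) hC he' r)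
    rw [one_div (n : ℝ)]
    nth_rw 1 [← Real.exp_log hN0]
    rw [← Real.exp_neg]
    refine sub_le_sub_left (Real.exp_le_exp.2 (neg_le_neg ?_)) 1
    have : (1 / (n : ℝ) ^ 2) ^ 2 * (n * r) = r / (n : ℝ) ^ 3 := by
      field_simp
    rw [this, le_div_iff₀ (by positivity)]
    linarith
  · rw [← ENNReal.ofReal_natCast]
    exact ENNReal.ofReal_le_ofReal (Nat.floor_le h0)

end Domination

theorem mainTheorem10 :
    ∃ c : ℝ, 0 < c ∧ ∃ k : ℕ, ∀ᶠ n : ℕ in Filter.atTop,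
      ∃ C : Domination.DomInstance n,
        (∀ i, C.p i = 1 / 2 + 1 / (n : ℝ) ^ 2 ∧ C.q i = 1 / 2) ∧
        Domination.rMin C (Domination.countAlgorithm n) (1 - 1 / (n : ℝ)) ≤
          ENNReal.ofReal (2 * (n : ℝ) ^ 3 * Real.log n) ∧
        ∀ σ : Domination.ArgmaxRule n,
          ENNReal.ofReal ((n : ℝ) ^ 4 / (2 ^ 14 * Real.log n)) ≤
            Domination.rMin C (Domination.maxAlgorithm σ) (4 / 5) ∧
          ENNReal.ofReal (c * n / Real.log n ^ k) * Domination.rMinBest C (3 / 4) ≤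
            Domination.rMin C (Domination.maxAlgorithm σ) (3 / 4) := by
  -- The quotient of n⁴/(2¹⁴ ln n) by 2n³ ln n is n/(2¹⁵ ln² n).
  refine ⟨1 / 2 ^ 15, by norm_num, 2, ?_⟩
  filter_upwards [Filter.eventually_ge_atTop 64,
    (Real.tendsto_log_atTop.comp tendsto_natCast_atTop_atTop).eventually_ge_atTop 4] with n hn hL
  replace hL : 4 ≤ Real.log n := hL
  have hN : (64 : ℝ) ≤ n := by exact_mod_cast hn
  have he : 1 / (n : ℝ) ^ 2 ≤ 1 / 2 := by
    rw [div_le_div_iff₀ (by positivity) (by norm_num)]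
    nlinarith
  have he0 : 0 ≤ 1 / (n : ℝ) ^ 2 := by positivity
  let C : Domination.DomInstance n :=
    { p := fun _ => 1 / 2 + 1 / (n : ℝ) ^ 2
      q := fun _ => 1 / 2
      q_nonneg := fun _ => by norm_num
      q_le_p := fun _ => by linarith
      p_le_one := fun _ => by linarith }
  have hC : ∀ i, C.p i = 1 / 2 + 1 / (n : ℝ) ^ 2 ∧ C.q i = 1 / 2 := fun _ => ⟨rfl, rfl⟩
  have hcount := Domination.rMin_count_le hC hn hL
  refine ⟨C, hC, hcount, fun σ => ?_⟩
  have hmax : ENNReal.ofReal ((n : ℝ) ^ 4 / (2 ^ 14 * Real.log n)) ≤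
      Domination.rMin C (Domination.maxAlgorithm σ) (3 / 4) :=
    Domination.le_rMin_of_successProb_lt (Nat.lt_floor_add_one _).le
      (Domination.successProb_max_lt hC σ hn hL (Nat.floor_le (by positivity)))
  refine ⟨hmax.trans (Domination.rMin_mono C _ (by norm_num)), le_trans ?_ hmax⟩
  have hbest : Domination.rMinBest C (3 / 4) ≤
      ENNReal.ofReal (2 * (n : ℝ) ^ 3 * Real.log n) := by
    refine (iInf_le _ (Domination.countAlgorithm n)).trans
      ((Domination.rMin_mono C _ ?_).trans hcount)
    have : 1 / (n : ℝ) ≤ 1 / 4 := by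
      rw [div_le_div_iff₀ (by positivity) (by norm_num)]
      linarith
    linarith
  refine (mul_le_mul_right hbest _).trans (le_of_eq ?_)
  rw [← ENNReal.ofReal_mul (by positivity)]
  congr 1
  field_simp
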